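/- An average-reward MDP consists of a finite state set $\mathcal S$, nonempty finite action sets $\mathcal A_i$ ($i\in\mathcal S$), transition probabilities $p_{ij}(a)$ and rewards $r_{i,a}\in[0,1]$; $\mathcal A=\{(i,a): i\in\mathcal S, a\in\mathcal A_i\}$ is the set of state-action pairs and $|\mathcal A|\ge 2$ its size. $\Delta^X$ denotes the set of probability vectors on a finite set $X$. A policy is a family $\pi=(\pi_i)_{i\in\mathcal S}$ with $\pi_i\in\Delta^{\mathcal A_i}$; $P^\pi(i,j)=\sum_{a\in\mathcal A_i}\pi_i(a)p_{ij}(a)$ is its transition matrix; and $\bar v^\pi=\lim_{T\to\infty}\frac1T\,\mathbb E^\pi\big[\sum_{t=1}^T r_{i_t,a_t}\mid i_1\sim q\big]$ is its average reward, for a given initial distribution $q\in\Delta^{\mathcal S}$. Put $\bar v^*=\sup_\pi\bar v^\pi$. Assume that every policy mixes within time $t_{\rm mix}\in\mathbb N$, $t_{\rm mix}\ge1$: for every policy $\pi$, with stationary distribution $\nu^\pi$, there is $1\le t\le t_{\rm mix}$ with $\max_{q\in\Delta^{\mathcal S}}\|((P^\pi)^\top)^tq-\nu^\pi\|_1\le\frac12$.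 Algorithm (parameters $\eta_v,\eta_\mu>0$, $T\ge1$). Let $M=2t_{\rm mix}$, let $v_0\in[-2M,2M]^{\mathcal S}$ be arbitrary and let $\mu_0\in\Delta^{\mathcal A}$ be uniform. For $t=1,\dots,T$: draw $(i,a)\sim\mu_{t-1}$ and then a next state $j\sim p_{i\cdot}(a)$ from the generative model, and set $\tilde g^v=e_j-e_i$; independently draw $(i',a')\in\mathcal A$ uniformly and then a next state $j'\sim p_{i'\cdot}(a')$ from the generative model, and set $\tilde g^\mu=|\mathcal A|\,(v_{t-1,i'}-v_{t-1,j'}-r_{i',a'})\,e_{i',a'}$; let $v_t$ be the projection of $v_{t-1}-\eta_v\tilde g^v$ onto $[-2M,2M]^{\mathcal S}$, and let $\mu_t$ be the vector $\mu_{t-1}\circ\exp(-\eta_\mu\tilde g^\mu)$ (entrywise) normalized to sum $1$. Output $(v^\epsilon,\mu^\epsilon)=\frac1T\sum_{t=1}^T(v_t,\mu_t)$. Theorem. There are absolute constants $c_v,c_\mu,C>0$ such that for all $\mathcal S$, $(\mathcal A_i)_{i\in\mathcal S}$ with $|\mathcal A|\ge2$, all integers $t_{\rm mix}\ge1$ and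 all $\epsilon\in(0,1)$ there is $T\ge1$ such that for every average-reward MDP on these state and action sets in which every policy mixes within time $t_{\rm mix}$, and every $v_0\in[-2M,2M]^{\mathcal S}$, the algorithm with $\eta_v=c_v\epsilon$, $\eta_\mu=c_\mu\,\epsilon\,t_{\rm mix}^{-2}|\mathcal A|^{-1}$ and $T$ iterations uses at most $C\,t_{\rm mix}^2\,|\mathcal A|\,\epsilon^{-2}\log|\mathcal A|$ samples from the generative model; its output $\mu^\epsilon$ splits almost surely in a unique way as $\mu^\epsilon_{i,a}=\lambda_i\,\pi_i(a)$ with $\lambda\in\Delta^{\mathcal S}$ and $\pi=\pi^\epsilon$ a policy; and, for every initial distribution $q$, the limits defining the average rewards exist and $\mathbb E\,\bar v^{\pi^\epsilon}\ge\bar v^*-\epsilon$. -/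

import Mathlib

open Filter Topology

noncomputable section

namespace AvgMDP

/-! ### Average-reward Markov decision processes -/

/-- A finite average-reward MDP with state set `S` and action sets `A i`, `i : S`. The state-action
pairs are the elements of `Σ i, A i`; `P x j` is the probability of moving to the state `j` when
the action of the pair `x` is taken at the state of `x`, and `r x ∈ [0,1]` is the reward. -/
structure MDP (S : Type*) (A : S → Type*) [Fintype S] where
  P : (Σ i, A i) → stdSimplex ℝ S
  r : (Σ i, A i) → ℝ
  r_nonneg : ∀ x, 0 ≤ r x
  r_le_one : ∀ x, r x ≤ 1

variable {S : Type*} {A : S → Type*} [Fintype S] [∀ i, Fintype (A i)]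

/-- A (randomized, stationary) policy: a distribution over `A i` for every state `i`. -/
abbrev Policy (S : Type*) (A : S → Type*) [∀ i, Fintype (A i)] :=
  ∀ i : S, stdSimplex ℝ (A i)

/-- The state transition matrix `P^π` of the Markov chain induced by the policy `π`. -/
def MDP.transMat (M : MDP S A) (π : Policy S A) : Matrix S S ℝ :=
  fun i j => ∑ a : A i, π i a * M.P ⟨i, a⟩ j

/-- `ν` is a stationary distribution of the policy `π`. -/
def MDP.IsStationary (M : MDP S A) (π : Policy S A) (ν : stdSimplex ℝ S) : Prop :=
  Matrix.mulVec (M.transMat π).transpose (⇑ν) = ⇑ν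

open Classical in
/-- Every policy mixes within time `tmix`: for every policy `π`, with stationary distribution `ν`,
there is a time `1 ≤ t ≤ tmix` at which the law of the state is within `ℓ₁`-distance `1/2` of `ν`,
whatever the initial distribution `q`. The least such `tmix` is the mixing time of the MDP. -/
def MDP.MixesWithin (M : MDP S A) (tmix : ℕ) : Prop :=
  ∀ π : Policy S A, ∃ ν : stdSimplex ℝ S, M.IsStationary π ν ∧
    ∃ t : ℕ, 1 ≤ t ∧ t ≤ tmix ∧ ∀ q : stdSimplex ℝ S,
      ∑ i, |Matrix.mulVec ((M.transMat π).transpose ^ t) (⇑q) i - ν i| ≤ 1 / 2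

/-- The law of the state-action pair after `t` transitions, when the initial state has law `q` and
actions are chosen by `π`. -/
def MDP.pairLaw (M : MDP S A) (q : stdSimplex ℝ S) (π : Policy S A) : ℕ → (Σ i, A i) → ℝ
  | 0, y => q y.1 * π y.1 y.2
  | t + 1, y => (∑ x, M.pairLaw q π t x * M.P x y.1) * π y.1 y.2

/-- The expected reward per step collected in the first `T` steps. -/
def MDP.meanReward (M : MDP S A) (q : stdSimplex ℝ S) (π : Policy S A) (T : ℕ) : ℝ :=
  (1 / (T : ℝ)) * ∑ t ∈ Finset.range T, ∑ x, M.pairLaw q π t x * M.r x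

/-- The average reward of the policy `π` (long-run limit of the expected reward per step). -/
def MDP.avgReward (M : MDP S A) (q : stdSimplex ℝ S) (π : Policy S A) : ℝ :=
  limUnder atTop (M.meanReward q π)

/-- The optimal average reward. -/
def MDP.optReward (M : MDP S A) (q : stdSimplex ℝ S) : ℝ :=
  ⨆ π : Policy S A, M.avgReward q π

/-- The splitting `μ (i, a) = lam i * π i a` of `μ` into state weights and a policy. -/
def IsSplitting (μ : (Σ i, A i) → ℝ) (lam : stdSimplex ℝ S) (π : Policy S A) : Prop :=
  ∀ (i : S) (a : A i), μ ⟨i, a⟩ = lam i * π i a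

/-! ### Randomized algorithms with access to a generative model -/

/-- The sampling distribution on a finite type given by a point of the simplex. -/
def toPMF {X : Type*} [Fintype X] (w : stdSimplex ℝ X) : PMF X :=
  PMF.ofFintype (fun x => ENNReal.ofReal (w x)) (by
    rw [← ENNReal.ofReal_sum_of_nonneg (fun x _ => stdSimplex.zero_le w x),
      stdSimplex.sum_eq_one, ENNReal.ofReal_one])

/-- A randomized algorithm that has no access to the transition probabilities except through a
generative model: it may return a value, draw a pair from a distribution of its own choice
(internal randomness), or ask the generative model for one next state at a chosen pair. -/
inductive Alg (X S α : Type*) [Fintype X]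
  | ret (a : α) : Alg X S α
  | draw (w : stdSimplex ℝ X) (k : X → Alg X S α) : Alg X S α
  | query (x : X) (k : S → Alg X S α) : Alg X S α

/-- The joint law of the output of the algorithm and of the number of samples that it takes from
the generative model, when the model answers a query at `x` by a state with law `P x`. -/
def Alg.law {X S α : Type*} [Fintype X] [Fintype S] (P : X → stdSimplex ℝ S) :
    Alg X S α → PMF (α × ℕ)
  | .ret a => PMF.pure (a, 0)
  | .draw w k => (toPMF w).bind fun x => (k x).law P
  | .query x k => (toPMF (P x)).bind fun s => ((k s).law P).map fun o => (o.1, o.2 + 1)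

/-- Expectation of a real random variable under a discrete law. -/
def expect {Ω : Type*} (p : PMF Ω) (f : Ω → ℝ) : ℝ :=
  ∑' ω, (p ω).toReal * f ω

/-! ### Stochastic mirror descent for the mixing saddle-point problem -/

/-- Projection onto the box `[-b, b]^S`. -/
def projBox (b : ℝ) (v : S → ℝ) : S → ℝ :=
  fun i => max (-b) (min b (v i))

/-- The multiplicative step `μ ∘ exp (-η g)` followed by (Kullback-Leibler) projection onto the
simplex, that is, by normalization. -/
def expStep {X : Type*} [Fintype X] (η : ℝ) (μ : stdSimplex ℝ X) (g : X → ℝ) : stdSimplex ℝ X :=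
  ⟨fun x => μ x * Real.exp (-(η * g x)) / ∑ y, μ y * Real.exp (-(η * g y)), by
    have h0 : ∀ x, 0 ≤ μ x * Real.exp (-(η * g x)) :=
      fun x => mul_nonneg (μ.2.1 x) (Real.exp_pos _).le
    have hs : 0 ≤ ∑ y, μ y * Real.exp (-(η * g y)) := Finset.sum_nonneg fun y _ => h0 y
    refine ⟨fun x => div_nonneg (h0 x) hs, ?_⟩
    rw [← Finset.sum_div]
    refine div_self fun h => ?_
    have h1 := (Finset.sum_eq_zero_iff_of_nonneg fun y _ => h0 y).1 h
    have h2 : ∀ y, μ y = 0 := fun y =>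
      (mul_eq_zero.1 (h1 y (Finset.mem_univ y))).resolve_right (Real.exp_pos _).ne'
    have h3 : ∑ y, μ y = 1 := μ.2.2
    simp [h2] at h3⟩

open Classical in
/-- The estimate `e_j - e_i` of the gradient in `v`, from a pair at state `i` and next state `j`. -/
def gradV (x : Σ i, A i) (j : S) : S → ℝ :=
  Pi.single j 1 - Pi.single x.1 1

open Classical in
/-- The estimate `|A| (v_i - v_j - r_{i,a}) e_{i,a}` of the gradient in `μ`, from the pair
`x = (i, a)` and next state `j`. -/
def gradMu (r : (Σ i, A i) → ℝ) (v : S → ℝ) (x : Σ i, A i) (j : S) : (Σ i, A i) → ℝ :=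
  Pi.single x ((Fintype.card (Σ i, A i) : ℝ) * (v x.1 - v j - r x))

/-- `n` iterations of the loop from the iterates `v`, `μ`, where `sv`, `sμ` accumulate the sums of
the iterates computed so far. -/
def smdLoop [Nonempty (Σ i, A i)] (r : (Σ i, A i) → ℝ) (b ηv ημ : ℝ) :
    ℕ → (S → ℝ) → stdSimplex ℝ (Σ i, A i) → (S → ℝ) → ((Σ i, A i) → ℝ) →
      Alg (Σ i, A i) S ((S → ℝ) × ((Σ i, A i) → ℝ))
  | 0, _, _, sv, sμ => .ret (sv, sμ)
  | n + 1, v, μ, sv, sμ =>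
    .draw μ fun x => .query x fun j =>
    .draw stdSimplex.barycenter fun y => .query y fun k =>
      let v' := projBox b (v - ηv • gradV x j)
      let μ' := expStep ημ μ (gradMu r v y k)
      smdLoop r b ηv ημ n v' μ' (sv + v') (sμ + ⇑μ')

/-- Post-processing of the output. -/
def Alg.map {X S α β : Type*} [Fintype X] (f : α → β) : Alg X S α → Alg X S β
  | .ret a => .ret (f a)
  | .draw w k => .draw w fun x => (k x).map f
  | .query x k => .query x fun s => (k s).map f

/-- Stochastic mirror descent for the mixing average-reward MDP with rewards `r`, box `[-b, b]^S`,
step sizes `ηv`, `ημ`, `T` iterations, initial box point `v₀` and the uniform distribution as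
initial simplex point. The output is the average `(1/T) ∑_{t=1}^T (v_t, μ_t)`. -/
def smd [Nonempty (Σ i, A i)] (r : (Σ i, A i) → ℝ) (b ηv ημ : ℝ) (T : ℕ) (v₀ : S → ℝ) :
    Alg (Σ i, A i) S ((S → ℝ) × ((Σ i, A i) → ℝ)) :=
  (smdLoop r b ηv ημ T v₀ stdSimplex.barycenter 0 0).map fun o =>
    ((T : ℝ)⁻¹ • o.1, (T : ℝ)⁻¹ • o.2)

end AvgMDP

end

open AvgMDP

universe u v

open Filter Topology

noncomputable section

namespace AvgMDP

open Matrix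

section chain

variable {S : Type*} {A : S → Type*} [Fintype S] [∀ i, Fintype (A i)]

/-! ### The Markov chain of a policy -/

/-! Write L(v, μ) for `lagr`. Two facts tie L to average rewards. At the occupancy measure of a
policy under its stationary law, v drops out and L is the average reward ρ of that policy
(`lagr_occupancy`). Conversely, if μ splits into weights and a policy π, and h nearly solves the
Poisson equation of π, then L(h, μ) is at most the average reward of π plus a small δ
(`exists_lagr_le`). Mixing supplies such an h inside the box (`exists_bias`), because mean-zero
functions are halved every mixing block. So it suffices to show that E L(h, μ^ε) ≥ ρ - O(ε) for
every comparison policy, where h depends on μ^ε.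

This is a regret bound. Exponential weights compete with the fixed occupancy measure
(`mean₂_crossEntropy_le`); projected gradient steps in v compete with h (`projBox_step`). The
difficulty is that h depends on all the randomness, so the gradient noise paired with h need not
have mean zero. Instead the noise is accumulated in a vector d, and d·h ≥ -κ|d|² - |S|b²/(4κ) for
every h in the box of radius b. The increments of d are centred given the past, so E|d|² ≤ 2T
(`mean₂_noise_sq_le`); with κ of order ε this fits the error budget.

`potential` packages the argument: its one-step inequality holds for every draw and every h, so only
quantities free of h are ever averaged (`potential_step`, `smdLoop_regret`). -/

lemma MDP.transMat_nonneg (M : MDP S A) (π : Policy S A) (i j : S) : 0 ≤ M.transMat π i j :=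
  Finset.sum_nonneg fun a _ => mul_nonneg (stdSimplex.zero_le _ a) (stdSimplex.zero_le _ j)

lemma MDP.transMat_sum (M : MDP S A) (π : Policy S A) (i : S) : ∑ j, M.transMat π i j = 1 := by
  simp only [MDP.transMat]
  rw [Finset.sum_comm]
  simp [← Finset.mul_sum]

/-- The expected reward in one step under a policy, as a function of the state. -/
def MDP.stepReward (M : MDP S A) (π : Policy S A) (i : S) : ℝ := ∑ a, π i a * M.r ⟨i, a⟩

lemma MDP.stepReward_nonneg (M : MDP S A) (π : Policy S A) (i : S) : 0 ≤ M.stepReward π i :=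
  Finset.sum_nonneg fun a _ => mul_nonneg (stdSimplex.zero_le _ a) (M.r_nonneg _)

lemma MDP.stepReward_le_one (M : MDP S A) (π : Policy S A) (i : S) : M.stepReward π i ≤ 1 := by
  rw [← stdSimplex.sum_eq_one (π i)]
  exact Finset.sum_le_sum fun a _ =>
    mul_le_of_le_one_right (stdSimplex.zero_le _ a) (M.r_le_one _)

lemma abs_sum_mul_le {X : Type*} [Fintype X] {w g : X → ℝ} {c : ℝ} (hg : ∀ x, |g x| ≤ c) :
    |∑ x, w x * g x| ≤ (∑ x, |w x|) * c := by
  rw [Finset.sum_mul]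
  refine (Finset.abs_sum_le_sum_abs _ _).trans (Finset.sum_le_sum fun x _ => ?_)
  rw [abs_mul]
  exact mul_le_mul_of_nonneg_left (hg x) (abs_nonneg _)

lemma stdSimplex_abs_sum_mul_le {X : Type*} [Fintype X] (w : stdSimplex ℝ X) {g : X → ℝ} {c : ℝ}
    (hg : ∀ x, |g x| ≤ c) : |∑ x, w x * g x| ≤ c := by
  refine (abs_sum_mul_le hg).trans_eq ?_
  simp [abs_of_nonneg (stdSimplex.zero_le w _)]

lemma MDP.abs_transMat_mulVec_le (M : MDP S A) (π : Policy S A) {g : S → ℝ} {c : ℝ}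
    (hg : ∀ i, |g i| ≤ c) (i : S) : |(M.transMat π *ᵥ g) i| ≤ c := by
  refine (abs_sum_mul_le hg).trans_eq ?_
  simp [abs_of_nonneg (M.transMat_nonneg π i _), M.transMat_sum]

open Classical in
lemma MDP.abs_transMat_pow_mulVec_le (M : MDP S A) (π : Policy S A) {g : S → ℝ} {c : ℝ}
    (hg : ∀ i, |g i| ≤ c) (t : ℕ) (i : S) : |(M.transMat π ^ t *ᵥ g) i| ≤ c := by
  induction t generalizing i with
  | zero => simpa using hg i
  | succ t ih =>
    rw [pow_succ', ← mulVec_mulVec]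
    exact M.abs_transMat_mulVec_le π ih i

open Classical in
lemma transpose_pow_mulVec_dotProduct (P : Matrix S S ℝ) (t : ℕ) (q g : S → ℝ) :
    (P.transpose ^ t *ᵥ q) ⬝ᵥ g = q ⬝ᵥ (P ^ t *ᵥ g) := by
  rw [← transpose_pow, mulVec_transpose, dotProduct_mulVec]

lemma MDP.IsStationary.dotProduct_mulVec {M : MDP S A} {π : Policy S A} {ν : stdSimplex ℝ S}
    (hν : M.IsStationary π ν) (g : S → ℝ) : ⇑ν ⬝ᵥ (M.transMat π *ᵥ g) = ⇑ν ⬝ᵥ g := by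
  conv_rhs => rw [← hν]
  rw [mulVec_transpose, ← Matrix.dotProduct_mulVec]

open Classical in
lemma MDP.IsStationary.dotProduct_pow_mulVec {M : MDP S A} {π : Policy S A} {ν : stdSimplex ℝ S}
    (hν : M.IsStationary π ν) (g : S → ℝ) (t : ℕ) :
    ⇑ν ⬝ᵥ (M.transMat π ^ t *ᵥ g) = ⇑ν ⬝ᵥ g := by
  induction t with
  | zero => simp
  | succ t ih => rw [pow_succ', ← mulVec_mulVec, hν.dotProduct_mulVec, ih]

open Classical in
/-- `ν` is stationary for `π`, and the chain of `π` is within `ℓ₁`-distance `1/2` of `ν` at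
time `t`. -/
structure MDP.MixesAt (M : MDP S A) (π : Policy S A) (ν : stdSimplex ℝ S) (t : ℕ) : Prop where
  stationary : M.IsStationary π ν
  one_le : 1 ≤ t
  le_half : ∀ q : stdSimplex ℝ S,
    ∑ i, |((M.transMat π).transpose ^ t *ᵥ ⇑q) i - ν i| ≤ 1 / 2

open Classical in
/-- Mixing contracts functions of mean zero by a factor two. -/
lemma MDP.MixesAt.contract {M : MDP S A} {π : Policy S A} {ν : stdSimplex ℝ S} {t : ℕ}
    (h : M.MixesAt π ν t) {g : S → ℝ} {c : ℝ} (hg : ∀ i, |g i| ≤ c) (h0 : ⇑ν ⬝ᵥ g = 0) (i : S) :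
    |(M.transMat π ^ t *ᵥ g) i| ≤ c / 2 := by
  have hc : 0 ≤ c := (abs_nonneg _).trans (hg i)
  -- Since g has mean zero, ν may be subtracted from the law at time t of the chain started at i;
  -- the sum is then controlled by an ℓ₁-distance.
  have key : (M.transMat π ^ t *ᵥ g) i =
      ∑ j, (((M.transMat π).transpose ^ t *ᵥ (Pi.single i (1 : ℝ))) j - ν j) * g j := by
    simp only [sub_mul, Finset.sum_sub_distrib]
    have h1 := transpose_pow_mulVec_dotProduct (M.transMat π) t (Pi.single i 1) g
    rw [single_one_dotProduct] at h1
    rw [← h1]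
    have h2 : ∑ j, ν j * g j = 0 := h0
    rw [h2, sub_zero]
    rfl
  rw [key]
  refine (abs_sum_mul_le hg).trans ?_
  have := h.le_half ⟨Pi.single i 1, single_mem_stdSimplex ℝ i⟩
  have h2 := mul_le_mul_of_nonneg_right this hc
  refine h2.trans (le_of_eq (by ring))

open Classical in
lemma MDP.MixesAt.abs_pow_le {M : MDP S A} {π : Policy S A} {ν : stdSimplex ℝ S} {t : ℕ}
    (h : M.MixesAt π ν t) (K : ℕ) {g : S → ℝ} {c : ℝ} (hg : ∀ i, |g i| ≤ c) (h0 : ⇑ν ⬝ᵥ g = 0)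
    (i : S) : |(M.transMat π ^ (t * K) *ᵥ g) i| ≤ c / 2 ^ K := by
  induction K generalizing g c with
  | zero => simpa using hg i
  | succ K ih =>
    rw [mul_add, mul_one, pow_add, ← mulVec_mulVec]
    refine (ih (h.contract hg h0) ?_).trans_eq ?_
    · rw [h.stationary.dotProduct_pow_mulVec, h0]
    · rw [pow_succ', div_div]

open Classical in
-- Cut time into blocks of length t. The first block costs at most t * c, and the rest is the same
-- problem with bound c / 2, so the geometric series gives 2 * t * c uniformly in N.
lemma MDP.MixesAt.sum_abs_le {M : MDP S A} {π : Policy S A} {ν : stdSimplex ℝ S} {t : ℕ}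
    (h : M.MixesAt π ν t) (N : ℕ) {g : S → ℝ} {c : ℝ} (hg : ∀ i, |g i| ≤ c) (h0 : ⇑ν ⬝ᵥ g = 0)
    (i : S) : ∑ s ∈ Finset.range N, |(M.transMat π ^ s *ᵥ g) i| ≤ 2 * t * c := by
  induction N using Nat.strong_induction_on generalizing g c with
  | _ N ih =>
    have hc : 0 ≤ c := (abs_nonneg _).trans (hg i)
    have short : ∀ n : ℕ, n ≤ t →
        ∑ s ∈ Finset.range n, |(M.transMat π ^ s *ᵥ g) i| ≤ t * c := fun n hn => by
      refine (Finset.sum_le_card_nsmul _ _ c fun s _ =>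
        M.abs_transMat_pow_mulVec_le π hg s i).trans ?_
      rw [Finset.card_range, nsmul_eq_mul]
      exact mul_le_mul_of_nonneg_right (by exact_mod_cast hn) hc
    rcases le_total N t with hN | hN
    · have := short N hN
      have h2 : 0 ≤ (t : ℝ) * c := by positivity
      linarith
    · obtain ⟨n, rfl⟩ := Nat.exists_eq_add_of_le hN
      rw [Finset.sum_range_add]
      have h1 := short t le_rfl
      have h2 := ih n (by have := h.one_le; omega) (h.contract hg h0)
        (by rw [h.stationary.dotProduct_pow_mulVec, h0])
      simp only [mulVec_mulVec, ← pow_add] at h2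
      simp only [add_comm t]
      linarith

/-! ### Average rewards -/

lemma MDP.sum_pairLaw (M : MDP S A) (q : stdSimplex ℝ S) (π : Policy S A) (t : ℕ)
    (F : (Σ i, A i) → ℝ) : ∑ x, M.pairLaw q π t x * F x =
      ∑ i, (open Classical in (M.transMat π).transpose ^ t *ᵥ ⇑q) i * ∑ a, π i a * F ⟨i, a⟩ := by
  classical
  suffices H : ∀ x : (Σ i, A i), M.pairLaw q π t x =
      ((M.transMat π).transpose ^ t *ᵥ ⇑q) x.1 * π x.1 x.2 by
    rw [Fintype.sum_sigma]
    refine Finset.sum_congr rfl fun i _ => ?_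
    rw [Finset.mul_sum]
    refine Finset.sum_congr rfl fun a _ => ?_
    rw [H]; simp only [mul_assoc]
  induction t with
  | zero => intro x; simp [MDP.pairLaw]
  | succ t ih =>
    intro y
    simp only [MDP.pairLaw, ih]
    congr 1
    rw [Fintype.sum_sigma, pow_succ', ← mulVec_mulVec]
    simp only [mulVec, dotProduct, transpose_apply, MDP.transMat]
    refine Finset.sum_congr rfl fun i _ => ?_
    rw [Finset.sum_mul]
    refine Finset.sum_congr rfl fun a _ => ?_
    ring

/-- The long-run reward `ν · r^π` under the law `ν` of the state. -/
def MDP.statReward (M : MDP S A) (π : Policy S A) (ν : stdSimplex ℝ S) : ℝ :=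
  ∑ i, ν i * M.stepReward π i

lemma MDP.statReward_nonneg (M : MDP S A) (π : Policy S A) (ν : stdSimplex ℝ S) :
    0 ≤ M.statReward π ν :=
  Finset.sum_nonneg fun i _ => mul_nonneg (stdSimplex.zero_le _ i) (M.stepReward_nonneg π i)

lemma MDP.statReward_le_one (M : MDP S A) (π : Policy S A) (ν : stdSimplex ℝ S) :
    M.statReward π ν ≤ 1 := by
  rw [← stdSimplex.sum_eq_one ν]
  exact Finset.sum_le_sum fun i _ =>
    mul_le_of_le_one_right (stdSimplex.zero_le _ i) (M.stepReward_le_one π i)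

/-- The reward of one step relative to the long-run reward. -/
def MDP.excess (M : MDP S A) (π : Policy S A) (ν : stdSimplex ℝ S) (i : S) : ℝ :=
  M.stepReward π i - M.statReward π ν

lemma MDP.abs_excess_le (M : MDP S A) (π : Policy S A) (ν : stdSimplex ℝ S) (i : S) :
    |M.excess π ν i| ≤ 1 := by
  rw [MDP.excess, abs_le]
  constructor <;> linarith [M.stepReward_nonneg π i, M.stepReward_le_one π i,
    M.statReward_nonneg π ν, M.statReward_le_one π ν]

lemma MDP.dotProduct_excess (M : MDP S A) (π : Policy S A) (ν : stdSimplex ℝ S) :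
    ⇑ν ⬝ᵥ M.excess π ν = 0 := by
  simp only [dotProduct, MDP.excess, mul_sub, Finset.sum_sub_distrib, ← Finset.sum_mul,
    stdSimplex.sum_eq_one, one_mul]
  exact sub_self _

open Classical in
lemma MDP.transMat_pow_mulVec_const (M : MDP S A) (π : Policy S A) (c : ℝ) (t : ℕ) :
    (M.transMat π ^ t *ᵥ fun _ => c) = fun _ => c := by
  induction t with
  | zero => simp
  | succ t ih =>
    rw [pow_succ', ← mulVec_mulVec, ih]
    ext i
    simp [mulVec, dotProduct, ← Finset.sum_mul, M.transMat_sum]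

open Classical in
lemma MDP.sum_pairLaw_reward (M : MDP S A) (q : stdSimplex ℝ S) (π : Policy S A)
    (ν : stdSimplex ℝ S) (t : ℕ) : ∑ x, M.pairLaw q π t x * M.r x =
      M.statReward π ν + ∑ i, q i * (M.transMat π ^ t *ᵥ M.excess π ν) i := by
  rw [M.sum_pairLaw]
  have h1 : M.stepReward π = M.excess π ν + fun _ => M.statReward π ν := by
    ext i; simp [MDP.excess]
  have h2 := transpose_pow_mulVec_dotProduct (M.transMat π) t q (M.stepReward π)
  refine h2.trans ?_
  rw [h1, mulVec_add, M.transMat_pow_mulVec_const, dotProduct_add, add_comm]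
  congr 1
  simp [dotProduct, ← Finset.sum_mul]

/-- The total deviation from the stationary reward stays below 2 * t whatever the horizon, so
dividing by T makes it vanish. -/
lemma MDP.MixesAt.tendsto_meanReward {M : MDP S A} {π : Policy S A} {ν : stdSimplex ℝ S} {t : ℕ}
    (h : M.MixesAt π ν t) (q : stdSimplex ℝ S) :
    Tendsto (M.meanReward q π) atTop (𝓝 (M.statReward π ν)) := by
  classical
  have hb : ∀ T : ℕ, 1 ≤ T → |M.meanReward q π T - M.statReward π ν| ≤ 2 * t / T := by
    intro T hT
    have hT0 : (0 : ℝ) < T := by exact_mod_cast hT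
    have h1 : M.meanReward q π T - M.statReward π ν =
        (∑ i, q i * ∑ s ∈ Finset.range T, (M.transMat π ^ s *ᵥ M.excess π ν) i) / T := by
      rw [MDP.meanReward]
      simp only [M.sum_pairLaw_reward q π ν, Finset.sum_add_distrib, Finset.sum_const,
        Finset.card_range, nsmul_eq_mul]
      simp only [Finset.mul_sum (s := Finset.range T)]
      rw [Finset.sum_comm]
      field_simp
      ring
    rw [h1, abs_div, abs_of_pos hT0]
    refine div_le_div_of_nonneg_right ?_ hT0.le
    refine stdSimplex_abs_sum_mul_le q fun i => (Finset.abs_sum_le_sum_abs _ _).trans ?_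
    simpa using h.sum_abs_le T (M.abs_excess_le π ν) (M.dotProduct_excess π ν) i
  rw [tendsto_iff_dist_tendsto_zero]
  refine squeeze_zero' (Eventually.of_forall fun _ => dist_nonneg) ?_
    (tendsto_const_div_atTop_nhds_zero_nat (2 * t : ℝ))
  filter_upwards [eventually_ge_atTop 1] with T hT
  exact hb T hT

lemma MDP.MixesAt.avgReward_eq {M : MDP S A} {π : Policy S A} {ν : stdSimplex ℝ S} {t : ℕ}
    (h : M.MixesAt π ν t) (q : stdSimplex ℝ S) : M.avgReward q π = M.statReward π ν :=
  (h.tendsto_meanReward q).limUnder_eq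

lemma MDP.MixesWithin.exists_mixesAt {M : MDP S A} {tmix : ℕ} (h : M.MixesWithin tmix)
    (π : Policy S A) : ∃ ν t, M.MixesAt π ν t ∧ t ≤ tmix := by
  obtain ⟨ν, hν, t, h1, h2, h3⟩ := h π
  exact ⟨ν, t, ⟨hν, h1, h3⟩, h2⟩

/-- An approximate solution of the Poisson equation, bounded in terms of the mixing time. -/
lemma MDP.MixesWithin.exists_bias {M : MDP S A} {tmix : ℕ} (hM : M.MixesWithin tmix)
    (q : stdSimplex ℝ S) (π : Policy S A) {δ : ℝ} (hδ : 0 < δ) :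
    ∃ h : S → ℝ, (∀ i, |h i| ≤ 2 * tmix) ∧
      ∀ i, (M.transMat π *ᵥ h) i - h i + M.stepReward π i ≤ M.avgReward q π + δ := by
  classical
  obtain ⟨ν, t, hm, ht⟩ := hM.exists_mixesAt π
  obtain ⟨K, hK⟩ := exists_pow_lt_of_lt_one hδ (by norm_num : (1 / 2 : ℝ) < 1)
  -- A truncated Poisson series: the sum telescopes, and stopping after K whole blocks leaves a
  -- remainder of size at most 1 / 2 ^ K < δ, so no limit is needed.
  refine ⟨∑ s ∈ Finset.range (t * K), M.transMat π ^ s *ᵥ M.excess π ν, fun i => ?_, fun i => ?_⟩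
  · rw [Finset.sum_apply]
    refine (Finset.abs_sum_le_sum_abs _ _).trans ?_
    have h1 := hm.sum_abs_le (t * K) (M.abs_excess_le π ν) (M.dotProduct_excess π ν) i
    have h2 : (t : ℝ) ≤ tmix := by exact_mod_cast ht
    linarith
  · have h1 : ∀ N : ℕ, (M.transMat π *ᵥ ∑ s ∈ Finset.range N, M.transMat π ^ s *ᵥ M.excess π ν) -
        ∑ s ∈ Finset.range N, M.transMat π ^ s *ᵥ M.excess π ν =
        M.transMat π ^ N *ᵥ M.excess π ν - M.excess π ν := by
      intro N
      induction N with
      | zero => simp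
      | succ N ih =>
        rw [Finset.sum_range_succ, mulVec_add, add_sub_add_comm, ih, mulVec_mulVec, ← pow_succ']
        abel
    have h2 := congrFun (h1 (t * K)) i
    simp only [Pi.sub_apply] at h2
    have h3 := le_of_abs_le
      (hm.abs_pow_le K (M.abs_excess_le π ν) (M.dotProduct_excess π ν) i)
    rw [h2, hm.avgReward_eq q]
    have h4 : (1 : ℝ) / 2 ^ K < δ := by simpa using hK
    simp only [MDP.excess] at h3 ⊢
    linarith

end chain

/-! ### Finite expectations -/

/-- The mean of `F` under the weights `w`. -/
def mean {X : Type*} [Fintype X] (w : stdSimplex ℝ X) (F : X → ℝ) : ℝ := ∑ x, w x * F x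

section mean

variable {X : Type*} [Fintype X] (w : stdSimplex ℝ X)

@[simp] lemma mean_const (c : ℝ) : mean w (fun _ => c) = c := by
  simp [mean, ← Finset.sum_mul]

lemma mean_add (F G : X → ℝ) : mean w (fun x => F x + G x) = mean w F + mean w G := by
  simp [mean, mul_add, Finset.sum_add_distrib]

lemma mean_sub (F G : X → ℝ) : mean w (fun x => F x - G x) = mean w F - mean w G := by
  simp [mean, mul_sub, Finset.sum_sub_distrib]

lemma mean_const_mul (c : ℝ) (F : X → ℝ) : mean w (fun x => c * F x) = c * mean w F := by
  simp [mean, Finset.mul_sum, mul_left_comm]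

variable {w} in
lemma mean_mono {F G : X → ℝ} (h : ∀ x, F x ≤ G x) : mean w F ≤ mean w G :=
  Finset.sum_le_sum fun x _ => mul_le_mul_of_nonneg_left (h x) (stdSimplex.zero_le w x)

end mean

/-- The mean of `F x s` when `x` has law `w` and, given `x`, `s` has law `P x`. -/
def mean₂ {X S : Type*} [Fintype X] [Fintype S] (P : X → stdSimplex ℝ S) (w : stdSimplex ℝ X)
    (F : X → S → ℝ) : ℝ := mean w fun x => mean (P x) (F x)

section mean₂

variable {X S : Type*} [Fintype X] [Fintype S] {P : X → stdSimplex ℝ S} {w : stdSimplex ℝ X}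

@[simp] lemma mean₂_const (c : ℝ) : mean₂ P w (fun _ _ => c) = c := by simp [mean₂]

lemma mean₂_add (F G : X → S → ℝ) :
    mean₂ P w (fun x s => F x s + G x s) = mean₂ P w F + mean₂ P w G := by
  simp only [mean₂, mean_add]

lemma mean₂_sub (F G : X → S → ℝ) :
    mean₂ P w (fun x s => F x s - G x s) = mean₂ P w F - mean₂ P w G := by
  simp only [mean₂, mean_sub]

lemma mean₂_const_mul (c : ℝ) (F : X → S → ℝ) :
    mean₂ P w (fun x s => c * F x s) = c * mean₂ P w F := by
  simp only [mean₂, mean_const_mul]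

lemma mean₂_mono {F G : X → S → ℝ} (h : ∀ x s, F x s ≤ G x s) : mean₂ P w F ≤ mean₂ P w G :=
  mean_mono fun x => mean_mono (h x)

lemma mean₂_sum {I : Type*} (s : Finset I) (F : I → X → S → ℝ) :
    mean₂ P w (fun x j => ∑ i ∈ s, F i x j) = ∑ i ∈ s, mean₂ P w (F i) := by
  classical
  induction s using Finset.induction_on with
  | empty => simp
  | insert i s hi ih => simp only [Finset.sum_insert hi, mean₂_add, ih]

end mean₂

/-! ### The law of an algorithm -/

namespace Alg

variable {X S α β : Type*} [Fintype X] [Fintype S]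

/-- The expectation of a function of the output of an algorithm. -/
def ev (P : X → stdSimplex ℝ S) (F : α → ℝ) : Alg X S α → ℝ
  | .ret a => F a
  | .draw w k => mean w fun x => (k x).ev P F
  | .query x k => mean (P x) fun s => (k s).ev P F

variable {P : X → stdSimplex ℝ S}

lemma ev_mono {F G : α → ℝ} (h : ∀ a, F a ≤ G a) (al : Alg X S α) : al.ev P F ≤ al.ev P G := by
  induction al with
  | ret a => exact h a
  | draw w k ih => exact mean_mono ih
  | query x k ih => exact mean_mono ih

lemma ev_add_const (F : α → ℝ) (c : ℝ) (al : Alg X S α) :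
    al.ev P (fun a => F a + c) = al.ev P F + c := by
  induction al with
  | ret a => rfl
  | draw w k ih => simp only [ev, ih, mean_add, mean_const]
  | query x k ih => simp only [ev, ih, mean_add, mean_const]

lemma ev_const_mul (F : α → ℝ) (c : ℝ) (al : Alg X S α) :
    al.ev P (fun a => c * F a) = c * al.ev P F := by
  induction al with
  | ret a => rfl
  | draw w k ih => simp only [ev, ih, mean_const_mul]
  | query x k ih => simp only [ev, ih, mean_const_mul]

lemma ev_map (f : α → β) (F : β → ℝ) (al : Alg X S α) :
    (al.map f).ev P F = al.ev P fun a => F (f a) := by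
  induction al with
  | ret a => rfl
  | draw w k ih => simp only [map, ev, ih]
  | query x k ih => simp only [map, ev, ih]

lemma hasSum_toPMF_bind {Ω Y : Type*} [Fintype Y] (w : stdSimplex ℝ Y) (p : Y → PMF Ω) (F : Ω → ℝ)
    (e : Y → ℝ) (h : ∀ y, HasSum (fun ω => (p y ω).toReal * F ω) (e y)) :
    HasSum (fun ω => (((toPMF w).bind p) ω).toReal * F ω) (mean w e) := by
  have h1 : ∀ ω, (((toPMF w).bind p) ω).toReal * F ω = ∑ y, w y * ((p y ω).toReal * F ω) := by
    intro ω
    rw [PMF.bind_apply, tsum_fintype, ENNReal.toReal_sum, Finset.sum_mul]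
    · refine Finset.sum_congr rfl fun y _ => ?_
      rw [ENNReal.toReal_mul, mul_assoc]
      congr 1
      exact ENNReal.toReal_ofReal (stdSimplex.zero_le w y)
    · exact fun y _ => ENNReal.mul_ne_top (PMF.apply_ne_top _ _) (PMF.apply_ne_top _ _)
  simp only [h1]
  exact hasSum_sum fun y _ => (h y).mul_left _

/-- The recursive expectation is the expectation under the law of the algorithm. -/
lemma hasSum_law (F : α → ℝ) (al : Alg X S α) :
    HasSum (fun o => (al.law P o).toReal * F o.1) (al.ev P F) := by
  classical
  induction al with
  | ret a =>
    convert hasSum_ite_eq ((a, 0) : α × ℕ) (F a) using 2 with o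
    by_cases h : o = (a, 0) <;> simp [law, PMF.pure_apply, h]
    rfl
  | draw w k ih => exact hasSum_toPMF_bind w _ _ _ ih
  | query x k ih =>
    refine hasSum_toPMF_bind _ _ _ _ fun s => ?_
    have hinj : Function.Injective fun o : α × ℕ => (o.1, o.2 + 1) := by
      rintro ⟨a, m⟩ ⟨b, n⟩ h
      simpa using h
    -- Counting the sample relabels outcomes injectively; outcomes outside the range carry no mass.
    rw [← hinj.hasSum_iff]
    · convert ih s using 2 with o
      simp only [Function.comp]
      congr 2
      rw [PMF.map_apply, tsum_eq_single o]
      · simp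
      · intro o' ho'
        rw [if_neg]
        exact fun h => ho' (hinj h.symm)
    · intro o ho
      rw [PMF.map_apply]
      have : ∀ o', o ≠ (fun o : α × ℕ => (o.1, o.2 + 1)) o' := fun o' h => ho ⟨o', h.symm⟩
      simp only [this, if_false, tsum_zero, ENNReal.toReal_zero, zero_mul]

lemma expect_law (F : α → ℝ) (al : Alg X S α) :
    expect (al.law P) (fun o => F o.1) = al.ev P F := (hasSum_law F al).tsum_eq

/-- Comparison on the support is all that is available: outputs are only assumed to split there. -/
lemma ev_le_expect {F G : α → ℝ} (al : Alg X S α) (h : ∀ o ∈ (al.law P).support, F o.1 ≤ G o.1) :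
    al.ev P F ≤ expect (al.law P) (fun o => G o.1) := by
  rw [← expect_law]
  refine (hasSum_law F al).summable.tsum_le_tsum (fun o => ?_) (hasSum_law G al).summable
  by_cases ho : o ∈ (al.law P).support
  · exact mul_le_mul_of_nonneg_left (h o ho) ENNReal.toReal_nonneg
  · rw [PMF.mem_support_iff, not_not] at ho
    simp [ho]

lemma mem_support_draw {w : stdSimplex ℝ X} {k : X → Alg X S α} {o : α × ℕ}
    (h : o ∈ ((Alg.draw w k).law P).support) : ∃ x, o ∈ ((k x).law P).support := by
  obtain ⟨x, -, hx⟩ := (PMF.mem_support_bind_iff _ _ _).1 h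
  exact ⟨x, hx⟩

lemma mem_support_query {x : X} {k : S → Alg X S α} {o : α × ℕ}
    (h : o ∈ ((Alg.query x k).law P).support) :
    ∃ s, ∃ o' ∈ ((k s).law P).support, o = (o'.1, o'.2 + 1) := by
  obtain ⟨s, -, hs⟩ := (PMF.mem_support_bind_iff _ _ _).1 h
  obtain ⟨o', h1, h2⟩ := (PMF.mem_support_map_iff _ _ _).1 hs
  exact ⟨s, o', h1, h2.symm⟩

lemma mem_support_map {f : α → β} {al : Alg X S α} {o : β × ℕ}
    (h : o ∈ ((al.map f).law P).support) : ∃ o' ∈ (al.law P).support, o = (f o'.1, o'.2) := by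
  induction al generalizing o with
  | ret a =>
    refine ⟨(a, 0), by simp [law], ?_⟩
    simpa [map, law] using h
  | draw w k ih =>
    obtain ⟨x, hx, h⟩ := (PMF.mem_support_bind_iff _ _ _).1 h
    obtain ⟨o', h1, h2⟩ := ih x h
    exact ⟨o', (PMF.mem_support_bind_iff _ _ _).2 ⟨x, hx, h1⟩, h2⟩
  | query x k ih =>
    obtain ⟨s, hs, h⟩ := (PMF.mem_support_bind_iff _ _ _).1 h
    obtain ⟨p, hp, rfl⟩ := (PMF.mem_support_map_iff _ _ _).1 h
    obtain ⟨o', h1, rfl⟩ := ih s hp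
    exact ⟨(o'.1, o'.2 + 1), (PMF.mem_support_bind_iff _ _ _).2
      ⟨s, hs, (PMF.mem_support_map_iff _ _ _).2 ⟨o', h1, rfl⟩⟩, rfl⟩

end Alg

variable {S : Type*} {A : S → Type*} [Fintype S] [∀ i, Fintype (A i)]

/-! ### Support of the output -/

lemma expStep_pos {X : Type*} [Fintype X] (η : ℝ) {μ : stdSimplex ℝ X} (g : X → ℝ)
    (hμ : ∀ x, 0 < μ x) (x : X) : 0 < expStep η μ g x := by
  have : Nonempty X := ⟨x⟩
  exact div_pos (mul_pos (hμ x) (Real.exp_pos _))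
    (Finset.sum_pos (fun y _ => mul_pos (hμ y) (Real.exp_pos _)) Finset.univ_nonempty)

/-- Exponential weights never vanish, so every iteration strictly increases each accumulated entry.
The non-strict clause carries the induction when no iterations remain. -/
lemma smdLoop_support [Nonempty (Σ i, A i)] {P : (Σ i, A i) → stdSimplex ℝ S}
    {r : (Σ i, A i) → ℝ} {b ηv ημ : ℝ} {n : ℕ} {v : S → ℝ} {μ : stdSimplex ℝ (Σ i, A i)}
    {sv : S → ℝ} {sμ : (Σ i, A i) → ℝ} (hμ : ∀ x, 0 < μ x)
    {o : ((S → ℝ) × ((Σ i, A i) → ℝ)) × ℕ}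
    (ho : o ∈ ((smdLoop r b ηv ημ n v μ sv sμ).law P).support) :
    o.2 = 2 * n ∧ ∑ x, o.1.2 x = n + ∑ x, sμ x ∧ ∀ x, (1 ≤ n → sμ x < o.1.2 x) ∧ sμ x ≤ o.1.2 x := by
  induction n generalizing v μ sv sμ o with
  | zero =>
    have : o = ((sv, sμ), 0) := by simpa [smdLoop, Alg.law] using ho
    subst this
    simp
  | succ n ih =>
    rw [smdLoop] at ho
    obtain ⟨x, ho1⟩ := Alg.mem_support_draw ho
    obtain ⟨j, o1, ho2, rfl⟩ := Alg.mem_support_query ho1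
    obtain ⟨y, ho3⟩ := Alg.mem_support_draw ho2
    obtain ⟨k, o, ho4, rfl⟩ := Alg.mem_support_query ho3
    have hpos := expStep_pos ημ (gradMu r v y k) hμ
    obtain ⟨h1, h2, h3⟩ := ih hpos ho4
    refine ⟨by simp only [h1]; ring, ?_, fun x => ?_⟩
    · simp only [h2, Pi.add_apply, Finset.sum_add_distrib, stdSimplex.sum_eq_one]
      push_cast; ring
    · have h4 := (h3 x).2
      have h5 := hpos x
      simp only [Pi.add_apply] at h4
      exact ⟨fun _ => by dsimp only; linarith, by dsimp only; linarith⟩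

/-- A positive probability vector on the state-action pairs splits uniquely. -/
lemma existsUnique_splitting {μ : (Σ i, A i) → ℝ} [∀ i, Nonempty (A i)] (hpos : ∀ x, 0 < μ x)
    (hsum : ∑ x, μ x = 1) :
    ∃! lp : stdSimplex ℝ S × Policy S A, IsSplitting μ lp.1 lp.2 := by
  have hl : ∀ i, 0 < ∑ a, μ ⟨i, a⟩ := fun i =>
    Finset.sum_pos (fun a _ => hpos _) Finset.univ_nonempty
  refine ⟨(⟨fun i => ∑ a, μ ⟨i, a⟩, fun i => (hl i).le, by rw [← Fintype.sum_sigma]; exact hsum⟩,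
    fun i => ⟨fun a => μ ⟨i, a⟩ / ∑ a, μ ⟨i, a⟩, fun a => (div_pos (hpos _) (hl i)).le, by
      rw [← Finset.sum_div]; exact div_self (hl i).ne'⟩), ?_, ?_⟩
  · intro i a
    exact (mul_div_cancel₀ _ (hl i).ne').symm
  · rintro ⟨lam, π⟩ h
    have h1 : ∀ i, lam i = ∑ a, μ ⟨i, a⟩ := fun i => by
      simp only [h i, ← Finset.mul_sum, stdSimplex.sum_eq_one, mul_one]
    refine Prod.ext (Subtype.ext (funext h1)) (funext fun i => Subtype.ext (funext fun a => ?_))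
    refine (eq_div_of_mul_eq (hl i).ne' ?_)
    rw [← h1, mul_comm]
    exact (h i a).symm

/-! ### The saddle-point function -/

/-- The objective `μᵀ((P - Î) v + r)` of the saddle-point problem. -/
def MDP.lagr (M : MDP S A) (v : S → ℝ) (μ : (Σ i, A i) → ℝ) : ℝ :=
  ∑ x, μ x * (mean (M.P x) v - v x.1 + M.r x)

lemma MDP.lagr_add (M : MDP S A) (v : S → ℝ) (μ μ' : (Σ i, A i) → ℝ) :
    M.lagr v (μ + μ') = M.lagr v μ + M.lagr v μ' := by
  simp [MDP.lagr, add_mul, Finset.sum_add_distrib]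

lemma MDP.lagr_smul (M : MDP S A) (v : S → ℝ) (c : ℝ) (μ : (Σ i, A i) → ℝ) :
    M.lagr v (c • μ) = c * M.lagr v μ := by
  simp [MDP.lagr, Finset.mul_sum, mul_assoc]

lemma abs_mean_le {X : Type*} [Fintype X] (w : stdSimplex ℝ X) {g : X → ℝ} {c : ℝ}
    (hg : ∀ x, |g x| ≤ c) : |mean w g| ≤ c := stdSimplex_abs_sum_mul_le w hg

lemma MDP.abs_lagr_le (M : MDP S A) {v : S → ℝ} {b : ℝ} (hv : ∀ i, |v i| ≤ b)
    (μ : stdSimplex ℝ (Σ i, A i)) : |M.lagr v μ| ≤ 2 * b + 1 := by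
  refine stdSimplex_abs_sum_mul_le μ fun x => ?_
  have h1 := abs_le.1 (abs_mean_le (M.P x) hv)
  have h2 := abs_le.1 (hv x.1)
  rw [abs_le]
  constructor <;> linarith [M.r_nonneg x, M.r_le_one x]

lemma MDP.sum_mean (M : MDP S A) (π : Policy S A) (v : S → ℝ) (i : S) :
    ∑ a, π i a * (mean (M.P ⟨i, a⟩) v - v i + M.r ⟨i, a⟩) =
      (M.transMat π *ᵥ v) i - v i + M.stepReward π i := by
  simp only [mul_add, mul_sub, Finset.sum_add_distrib, Finset.sum_sub_distrib, ← Finset.sum_mul,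
    stdSimplex.sum_eq_one, one_mul, MDP.stepReward, mulVec, dotProduct, MDP.transMat, mean,
    Finset.mul_sum]
  congr 2
  rw [Finset.sum_comm]
  simp only [Finset.sum_mul, mul_assoc]

lemma MDP.lagr_splitting (M : MDP S A) {μ : (Σ i, A i) → ℝ} {lam : stdSimplex ℝ S}
    {π : Policy S A} (h : IsSplitting μ lam π) (v : S → ℝ) :
    M.lagr v μ = ∑ i, lam i * ((M.transMat π *ᵥ v) i - v i + M.stepReward π i) := by
  rw [MDP.lagr, Fintype.sum_sigma]
  refine Finset.sum_congr rfl fun i _ => ?_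
  rw [← M.sum_mean, Finset.mul_sum]
  refine Finset.sum_congr rfl fun a _ => ?_
  rw [h i a, mul_assoc]

/-- The stationary law of the state-action pair. -/
def occupancy (π : Policy S A) (ν : stdSimplex ℝ S) : stdSimplex ℝ (Σ i, A i) :=
  ⟨fun x => ν x.1 * π x.1 x.2,
    fun x => mul_nonneg (stdSimplex.zero_le _ _) (stdSimplex.zero_le _ _), by
    rw [Fintype.sum_sigma, ← stdSimplex.sum_eq_one ν]
    refine Finset.sum_congr rfl fun i _ => ?_
    have h : ∑ a, π i a = 1 := (π i).2.2
    dsimp only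
    rw [← Finset.mul_sum, h, mul_one]⟩

/-- At a stationary law, the saddle-point function does not depend on the value vector. -/
lemma MDP.IsStationary.lagr_occupancy {M : MDP S A} {π : Policy S A} {ν : stdSimplex ℝ S}
    (hν : M.IsStationary π ν) (v : S → ℝ) : M.lagr v (occupancy π ν) = M.statReward π ν := by
  rw [M.lagr_splitting (lam := ν) (π := π) fun i a => rfl]
  simp only [mul_add, mul_sub, Finset.sum_add_distrib, Finset.sum_sub_distrib]
  have : ∑ i, ν i * (M.transMat π *ᵥ v) i = ∑ i, ν i * v i := hν.dotProduct_mulVec v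
  rw [this, sub_self, zero_add, MDP.statReward]

/-- The Poisson inequality holds at every state, so it survives averaging under any `lam`,
stationary or not. Hence h depends on the policy alone. -/
lemma MDP.MixesWithin.exists_lagr_le {M : MDP S A} {tmix : ℕ} (hM : M.MixesWithin tmix)
    (q : stdSimplex ℝ S) (π : Policy S A) {δ : ℝ} (hδ : 0 < δ) :
    ∃ h : S → ℝ, (∀ i, |h i| ≤ 2 * tmix) ∧ ∀ (μ : (Σ i, A i) → ℝ) (lam : stdSimplex ℝ S),
      IsSplitting μ lam π → M.lagr h μ ≤ M.avgReward q π + δ := by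
  obtain ⟨h, h1, h2⟩ := hM.exists_bias q π hδ
  refine ⟨h, h1, fun μ lam hs => ?_⟩
  rw [M.lagr_splitting hs]
  exact (mean_mono (w := lam) h2).trans_eq (mean_const _ _)

/-! ### The step in `v` -/

omit [∀ i, Fintype (A i)] in
lemma sum_mul_gradV (x : Σ i, A i) (j : S) (u : S → ℝ) :
    ∑ i, u i * gradV x j i = u j - u x.1 := by
  classical
  simp only [gradV, Pi.sub_apply, mul_sub, Finset.sum_sub_distrib, Pi.single_apply, mul_ite,
    mul_one, mul_zero]
  simp

omit [∀ i, Fintype (A i)] in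
lemma sum_gradV_sq_le (x : Σ i, A i) (j : S) : ∑ i, gradV x j i ^ 2 ≤ 2 := by
  classical
  have h : ∀ i, gradV x j i ^ 2 ≤ (if i = j then 1 else 0) + (if i = x.1 then (1 : ℝ) else 0) := by
    intro i
    simp only [gradV, Pi.sub_apply, Pi.single_apply]
    split_ifs <;> norm_num
  refine (Finset.sum_le_sum fun i _ => h i).trans ?_
  rw [Finset.sum_add_distrib]
  norm_num

/-- The exact gradient in `v`. -/
def MDP.meanGradV (M : MDP S A) (μ : stdSimplex ℝ (Σ i, A i)) (i : S) : ℝ :=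
  mean₂ M.P μ fun x j => gradV x j i

lemma MDP.mean₂_sum_mul_gradV (M : MDP S A) (μ : stdSimplex ℝ (Σ i, A i)) (u : S → ℝ) :
    mean₂ M.P μ (fun x j => ∑ i, u i * gradV x j i) = ∑ i, u i * M.meanGradV μ i := by
  rw [mean₂_sum]
  simp only [mean₂_const_mul, MDP.meanGradV]

/-- Used both at the iterate v and at the comparator h: the gradient is the same, which is what
links the two players. -/
lemma MDP.lagr_eq (M : MDP S A) (u : S → ℝ) (μ : stdSimplex ℝ (Σ i, A i)) :
    M.lagr u μ = mean μ M.r + ∑ i, u i * M.meanGradV μ i := by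
  rw [← M.mean₂_sum_mul_gradV]
  simp only [sum_mul_gradV, mean₂, mean_sub, mean_const]
  simp only [MDP.lagr, mean, mul_add, mul_sub, Finset.sum_add_distrib, Finset.sum_sub_distrib]
  ring

/-- The noise of the gradient estimates adds up in quadratic mean only. -/
lemma MDP.mean₂_noise_sq_le (M : MDP S A) (μ : stdSimplex ℝ (Σ i, A i)) (d : S → ℝ) :
    mean₂ M.P μ (fun x j => ∑ i, (d i + M.meanGradV μ i - gradV x j i) ^ 2) ≤
      ∑ i, d i ^ 2 + 2 := by
  have h1 : ∀ (x : Σ i, A i) (j : S), ∑ i, (d i + M.meanGradV μ i - gradV x j i) ^ 2 ≤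
      (∑ i, (d i + M.meanGradV μ i) ^ 2 + 2) -
        ∑ i, (2 * (d i + M.meanGradV μ i)) * gradV x j i := by
    intro x j
    have h2 := sum_gradV_sq_le x j
    have h3 : ∑ i, (d i + M.meanGradV μ i - gradV x j i) ^ 2 =
        ∑ i, (d i + M.meanGradV μ i) ^ 2 + ∑ i, gradV x j i ^ 2 -
        ∑ i, (2 * (d i + M.meanGradV μ i)) * gradV x j i := by
      rw [← Finset.sum_add_distrib, ← Finset.sum_sub_distrib]
      exact Finset.sum_congr rfl fun i _ => by ring
    linarith
  refine (mean₂_mono h1).trans ?_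
  rw [mean₂_sub, mean₂_const, M.mean₂_sum_mul_gradV]
  -- Centring of the noise: the cross terms cancel up to -`meanGradV` squared, which is dropped.
  have h4 : ∑ i, (d i + M.meanGradV μ i) ^ 2 - ∑ i, 2 * (d i + M.meanGradV μ i) * M.meanGradV μ i
      ≤ ∑ i, d i ^ 2 := by
    rw [← Finset.sum_sub_distrib]
    exact Finset.sum_le_sum fun i _ => by nlinarith [sq_nonneg (M.meanGradV μ i)]
  linarith

omit [Fintype S] in
lemma abs_projBox_le {b : ℝ} (hb : 0 ≤ b) (v : S → ℝ) (i : S) : |projBox b v i| ≤ b := by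
  rw [projBox, abs_le]
  exact ⟨le_max_left _ _, max_le (by linarith) (min_le_left _ _)⟩

omit [Fintype S] in
lemma projBox_sub_sq_le {b : ℝ} {h : S → ℝ} (hh : ∀ i, |h i| ≤ b) (v : S → ℝ) (i : S) :
    (projBox b v i - h i) ^ 2 ≤ (v i - h i) ^ 2 := by
  obtain ⟨h1, h2⟩ := abs_le.1 (hh i)
  rw [projBox]
  rcases le_total b (v i) with h3 | h3
  · rw [min_eq_left h3, max_eq_right (by linarith)]
    nlinarith
  · rw [min_eq_right h3]
    rcases le_total (-b) (v i) with h4 | h4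
    · rw [max_eq_right h4]
    · rw [max_eq_left h4]
      nlinarith

omit [∀ i, Fintype (A i)] in
lemma projBox_step {b η : ℝ} (hη : 0 < η) {h : S → ℝ} (hh : ∀ i, |h i| ≤ b) (v : S → ℝ)
    (x : Σ i, A i) (j : S) :
    (∑ i, (projBox b (v - η • gradV x j) i - h i) ^ 2) / (2 * η) +
      ∑ i, (v i - h i) * gradV x j i - η ≤ (∑ i, (v i - h i) ^ 2) / (2 * η) := by
  have h1 : ∑ i, (projBox b (v - η • gradV x j) i - h i) ^ 2 ≤
      ∑ i, (v i - h i) ^ 2 - 2 * η * ∑ i, (v i - h i) * gradV x j i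
        + η ^ 2 * ∑ i, gradV x j i ^ 2 := by
    rw [Finset.mul_sum, Finset.mul_sum, ← Finset.sum_sub_distrib, ← Finset.sum_add_distrib]
    refine Finset.sum_le_sum fun i _ => (projBox_sub_sq_le hh _ i).trans_eq ?_
    simp only [Pi.sub_apply, Pi.smul_apply, smul_eq_mul]
    ring
  have h2 := mul_le_mul_of_nonneg_left (sum_gradV_sq_le x j) (sq_nonneg η)
  have h3 : (∑ i, (v i - h i) ^ 2) / (2 * η) -
      ((∑ i, (projBox b (v - η • gradV x j) i - h i) ^ 2) / (2 * η) +
      ∑ i, (v i - h i) * gradV x j i - η) =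
      (∑ i, (v i - h i) ^ 2 - 2 * η * ∑ i, (v i - h i) * gradV x j i + η ^ 2 * 2 -
        ∑ i, (projBox b (v - η • gradV x j) i - h i) ^ 2) / (2 * η) := by
    field_simp
    ring
  have h4 := div_nonneg (by linarith : 0 ≤ ∑ i, (v i - h i) ^ 2 -
    2 * η * ∑ i, (v i - h i) * gradV x j i + η ^ 2 * 2 -
        ∑ i, (projBox b (v - η • gradV x j) i - h i) ^ 2) (by linarith : 0 ≤ 2 * η)
  linarith

/-! ### The step in `μ` -/

/-- The cross entropy of `μs` relative to `μ`. -/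
def crossEntropy {X : Type*} [Fintype X] (μs μ : stdSimplex ℝ X) : ℝ :=
  mean μs fun x => -Real.log (μ x)

/-- Lets the final value be discarded. Cross entropy differs from relative entropy by a term
depending only on `μs`, so it serves equally well and avoids logarithms of `μs`. -/
lemma crossEntropy_nonneg {X : Type*} [Fintype X] (μs μ : stdSimplex ℝ X) :
    0 ≤ crossEntropy μs μ :=
  Finset.sum_nonneg fun _ _ => mul_nonneg (stdSimplex.zero_le _ _) <| neg_nonneg.2 <|
    Real.log_nonpos (stdSimplex.zero_le _ _) (stdSimplex.le_one _ _)

/-- From exp(-x) ≤ 1 - x + x² for |x| ≤ 1 and log Z ≤ Z - 1. The quadratic term is averaged under μ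
itself, which later saves a factor of the number of pairs. -/
lemma crossEntropy_expStep_le {X : Type*} [Fintype X] {η : ℝ} (μs : stdSimplex ℝ X)
    {μ : stdSimplex ℝ X} (hμ : ∀ x, 0 < μ x) {g : X → ℝ} (hg : ∀ x, |η * g x| ≤ 1) :
    crossEntropy μs (expStep η μ g) ≤
      crossEntropy μs μ + η * mean μs g - η * mean μ g + η ^ 2 * mean μ fun x => g x ^ 2 := by
  have hne : Nonempty X := by
    by_contra h
    rw [not_nonempty_iff] at h
    simpa using stdSimplex.sum_eq_one μ
  set Z := ∑ y, μ y * Real.exp (-(η * g y)) with hZ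
  have hZpos : 0 < Z :=
    Finset.sum_pos (fun y _ => mul_pos (hμ y) (Real.exp_pos _)) Finset.univ_nonempty
  have h1 : ∀ x, -Real.log (expStep η μ g x) = -Real.log (μ x) + η * g x + Real.log Z := by
    intro x
    have : expStep η μ g x = μ x * Real.exp (-(η * g x)) / Z := rfl
    rw [this, Real.log_div (mul_pos (hμ x) (Real.exp_pos _)).ne' hZpos.ne',
      Real.log_mul (hμ x).ne' (Real.exp_pos _).ne', Real.log_exp]
    ring
  have h2 : Real.log Z ≤ -(η * mean μ g) + η ^ 2 * mean μ fun x => g x ^ 2 := by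
    refine (Real.log_le_sub_one_of_pos hZpos).trans ?_
    have h3 : Z ≤ mean μ fun x => 1 - η * g x + η ^ 2 * g x ^ 2 := by
      refine mean_mono fun x => ?_
      have := (abs_le.1 (Real.abs_exp_sub_one_sub_id_le (x := -(η * g x))
        (by rw [abs_neg]; exact hg x))).2
      nlinarith
    rw [mean_add, mean_sub, mean_const, mean_const_mul, mean_const_mul] at h3
    linarith
  simp only [crossEntropy, h1, mean_add, mean_const, mean_const_mul]
  linarith

lemma crossEntropy_barycenter {X : Type*} [Fintype X] [Nonempty X] (μs : stdSimplex ℝ X) :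
    crossEntropy μs stdSimplex.barycenter = Real.log (Fintype.card X) := by
  have : ∀ x : X, (stdSimplex.barycenter : stdSimplex ℝ X) x = (Fintype.card X : ℝ)⁻¹ :=
    fun x => rfl
  simp [crossEntropy, this, Real.log_inv]

lemma mean_gradMu (r : (Σ i, A i) → ℝ) (v : S → ℝ) (y : Σ i, A i) (k : S)
    (w : stdSimplex ℝ (Σ i, A i)) : mean w (gradMu r v y k) =
      w y * ((Fintype.card (Σ i, A i) : ℝ) * (v y.1 - v k - r y)) := by
  classical
  simp only [mean, gradMu, Pi.single_apply, mul_ite, mul_zero]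
  simp

lemma mean_gradMu_sq (r : (Σ i, A i) → ℝ) (v : S → ℝ) (y : Σ i, A i) (k : S)
    (w : stdSimplex ℝ (Σ i, A i)) : (mean w fun x => gradMu r v y k x ^ 2) =
      w y * ((Fintype.card (Σ i, A i) : ℝ) * (v y.1 - v k - r y)) ^ 2 := by
  classical
  simp only [mean, gradMu, Pi.single_apply, ite_pow, mul_ite, ne_eq, OfNat.ofNat_ne_zero,
    not_false_eq_true, zero_pow, mul_zero]
  simp

omit [∀ i, Fintype (A i)] in
lemma MDP.abs_advantage_le (M : MDP S A) {v : S → ℝ} {b : ℝ} (hv : ∀ i, |v i| ≤ b)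
    (y : Σ i, A i) (k : S) : |v y.1 - v k - M.r y| ≤ 2 * b + 1 := by
  have h1 := abs_le.1 (hv k)
  have h2 := abs_le.1 (hv y.1)
  rw [abs_le]
  constructor <;> linarith [M.r_nonneg y, M.r_le_one y]

lemma MDP.abs_gradMu_le (M : MDP S A) {v : S → ℝ} {b : ℝ} (hv : ∀ i, |v i| ≤ b)
    (y : Σ i, A i) (k : S) (x : Σ i, A i) :
    |gradMu M.r v y k x| ≤ (Fintype.card (Σ i, A i) : ℝ) * (2 * b + 1) := by
  classical
  have h := M.abs_advantage_le hv y k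
  have hb : 0 ≤ 2 * b + 1 := (abs_nonneg _).trans h
  simp only [gradMu, Pi.single_apply]
  split_ifs
  · rw [abs_mul, Nat.abs_cast]
    exact mul_le_mul_of_nonneg_left h (Nat.cast_nonneg _)
  · rw [abs_zero]; positivity

/-- The expected decrease of the cross entropy in one step. -/
lemma MDP.mean₂_crossEntropy_le [Nonempty (Σ i, A i)] (M : MDP S A) {v : S → ℝ} {b η : ℝ}
    (hv : ∀ i, |v i| ≤ b) (hη : 0 < η)
    (hηb : η * ((Fintype.card (Σ i, A i) : ℝ) * (2 * b + 1)) ≤ 1)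
    (μs : stdSimplex ℝ (Σ i, A i)) {μ : stdSimplex ℝ (Σ i, A i)} (hμ : ∀ x, 0 < μ x) :
    mean₂ M.P stdSimplex.barycenter
      (fun y k => crossEntropy μs (expStep η μ (gradMu M.r v y k))) ≤
    crossEntropy μs μ + η * (M.lagr v μ - M.lagr v μs) +
      η ^ 2 * ((Fintype.card (Σ i, A i) : ℝ) * (2 * b + 1) ^ 2) := by
  set N : ℝ := (Fintype.card (Σ i, A i) : ℝ) with hN
  have hNpos : 0 < N := by rw [hN]; exact_mod_cast Fintype.card_pos
  have hbar : ∀ x : Σ i, A i, (stdSimplex.barycenter : stdSimplex ℝ (Σ i, A i)) x = N⁻¹ :=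
    fun x => rfl
  have h1 : ∀ y k, crossEntropy μs (expStep η μ (gradMu M.r v y k)) ≤
      (crossEntropy μs μ + η ^ 2 * ((μ y * N ^ 2) * (2 * b + 1) ^ 2)) +
      (η * N * (μs y - μ y)) * (v y.1 - v k - M.r y) := by
    intro y k
    refine (crossEntropy_expStep_le μs hμ fun x => ?_).trans ?_
    · rw [abs_mul, abs_of_pos hη]
      exact (mul_le_mul_of_nonneg_left (M.abs_gradMu_le hv y k x) hη.le).trans hηb
    · rw [mean_gradMu, mean_gradMu, mean_gradMu_sq, ← hN]
      have h2 : (v y.1 - v k - M.r y) ^ 2 ≤ (2 * b + 1) ^ 2 :=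
        sq_le_sq.2 ((M.abs_advantage_le hv y k).trans (le_abs_self _))
      have h3 : μ y * (N * (v y.1 - v k - M.r y)) ^ 2 ≤ μ y * N ^ 2 * (2 * b + 1) ^ 2 := by
        rw [mul_pow, ← mul_assoc]
        exact mul_le_mul_of_nonneg_left h2 (mul_nonneg (hμ y).le (sq_nonneg _))
      have h4 := mul_le_mul_of_nonneg_left h3 (sq_nonneg η)
      linarith
  refine (mean₂_mono h1).trans_eq ?_
  simp only [mean₂, mean_add, mean_const, mean_const_mul, mean_sub]
  rw [add_right_comm, add_assoc, add_assoc]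
  congr 1
  congr 1
  · rw [MDP.lagr, MDP.lagr, ← Finset.sum_sub_distrib, Finset.mul_sum, mean]
    refine Finset.sum_congr rfl fun y _ => ?_
    rw [hbar]
    field_simp
    ring
  -- The sampling probability 1 / N cancels one factor of N ^ 2 and μ has mass one: the second
  -- moment is linear in N.
  · have h5 : (mean stdSimplex.barycenter fun y => μ y * N ^ 2 * (2 * b + 1) ^ 2) =
        ∑ y, μ y * (N * (2 * b + 1) ^ 2) := by
      refine Finset.sum_congr rfl fun y _ => ?_
      rw [hbar]
      field_simp
    rw [h5, ← Finset.sum_mul, stdSimplex.sum_eq_one, one_mul]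

/-! ### The regret of the loop -/

/-- The comparison functional of the loop at the iterates `v`, `μ`, with accumulated iterates `sμ`
and accumulated noise `d`, for an output `sμ'` and a comparator `h` that may depend on it. -/
def MDP.potential (M : MDP S A) (ηv : ℝ) (v : S → ℝ) (μ : stdSimplex ℝ (Σ i, A i))
    (sμ : (Σ i, A i) → ℝ) (d h : S → ℝ) (sμ' : (Σ i, A i) → ℝ) : ℝ :=
  M.lagr h (sμ' - sμ + ⇑μ) + (∑ i, (v i - h i) ^ 2) / (2 * ηv) + ∑ i, d i * h i

/-- The h-terms cancel: the exact gradient from L(h, μ) and the sampled one from the projection step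
differ by the noise, which the new d absorbs. The bracketed gain is free of h. -/
lemma MDP.potential_step (M : MDP S A) {b ηv : ℝ} (hηv : 0 < ηv) {h : S → ℝ}
    (hh : ∀ i, |h i| ≤ b) (v d : S → ℝ) (μ μ' : stdSimplex ℝ (Σ i, A i))
    (sμ sμ' : (Σ i, A i) → ℝ) (x : Σ i, A i) (j : S) :
    M.potential ηv (projBox b (v - ηv • gradV x j)) μ' (sμ + ⇑μ')
        (fun i => d i + M.meanGradV μ i - gradV x j i) h sμ' +
      (mean μ M.r + ∑ i, v i * gradV x j i - ηv) ≤ M.potential ηv v μ sμ d h sμ' := by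
  have h1 := projBox_step hηv hh v x j
  have h2 : sμ' - sμ + ⇑μ = (sμ' - (sμ + ⇑μ') + ⇑μ') + ⇑μ := by abel
  simp only [MDP.potential]
  rw [h2, M.lagr_add h _ ⇑μ, M.lagr_eq h μ]
  have h3 : ∑ i, (d i + M.meanGradV μ i - gradV x j i) * h i = ∑ i, d i * h i +
      ∑ i, h i * M.meanGradV μ i + ∑ i, (v i - h i) * gradV x j i - ∑ i, v i * gradV x j i := by
    rw [← Finset.sum_add_distrib, ← Finset.sum_add_distrib, ← Finset.sum_sub_distrib]
    exact Finset.sum_congr rfl fun i _ => by ring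
  linarith

/-- Completing the square in d·h bounds it for all h in the box at once. With nothing left to
accumulate, the Lagrangian part is only that of the last iterate. -/
lemma MDP.potential_lower_bound (M : MDP S A) {b ηv κ : ℝ} (hηv : 0 < ηv) (hκ : 0 < κ)
    {h : S → ℝ} (hh : ∀ i, |h i| ≤ b) (v d : S → ℝ) (μ : stdSimplex ℝ (Σ i, A i))
    (sμ : (Σ i, A i) → ℝ) :
    -(κ * ∑ i, d i ^ 2) - (Fintype.card S * b ^ 2 / (4 * κ) + (2 * b + 1)) ≤
      M.potential ηv v μ sμ d h sμ := by
  have h1 := (abs_le.1 (M.abs_lagr_le hh μ)).1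
  have h2 : 0 ≤ (∑ i, (v i - h i) ^ 2) / (2 * ηv) :=
    div_nonneg (Finset.sum_nonneg fun i _ => sq_nonneg _) (by linarith)
  have h3 : ∀ i, -(κ * d i ^ 2) - b ^ 2 / (4 * κ) ≤ d i * h i := by
    intro i
    have h4 : h i ^ 2 ≤ b ^ 2 := sq_le_sq.2 ((hh i).trans (le_abs_self _))
    have h5 : d i * h i + κ * d i ^ 2 + b ^ 2 / (4 * κ) =
        ((2 * κ * d i + h i) ^ 2 + (b ^ 2 - h i ^ 2)) / (4 * κ) := by
      field_simp
      ring
    have h6 : 0 ≤ ((2 * κ * d i + h i) ^ 2 + (b ^ 2 - h i ^ 2)) / (4 * κ) :=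
      div_nonneg (by nlinarith [sq_nonneg (2 * κ * d i + h i)]) (by linarith)
    linarith
  have h7 := Finset.sum_le_sum fun i (_ : i ∈ Finset.univ) => h3 i
  rw [Finset.sum_sub_distrib, Finset.sum_neg_distrib, ← Finset.mul_sum, Finset.sum_const,
    Finset.card_univ, nsmul_eq_mul, ← mul_div_assoc] at h7
  simp only [MDP.potential, sub_self, zero_add]
  linarith

/-- Each iteration gains L(v, μ) from the v-step on average; the cross-entropy decrease turns this
into ρ, and the noise costs 2κ. The comparator h reads the final output, so it stays inside `ev` and
the step is applied outcome by outcome. -/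
lemma MDP.smdLoop_regret [Nonempty (Σ i, A i)] (M : MDP S A) {b ηv ημ κ : ℝ} (hb : 0 ≤ b)
    (hηv : 0 < ηv) (hημ : 0 < ημ) (hκ : 0 < κ)
    (hηb : ημ * ((Fintype.card (Σ i, A i) : ℝ) * (2 * b + 1)) ≤ 1)
    {μs : stdSimplex ℝ (Σ i, A i)} {ρ : ℝ} (hρ : ∀ v, M.lagr v μs = ρ)
    {h : (S → ℝ) × ((Σ i, A i) → ℝ) → S → ℝ} (hh : ∀ o i, |h o i| ≤ b) (n : ℕ)
    {v : S → ℝ} (hv : ∀ i, |v i| ≤ b) {μ : stdSimplex ℝ (Σ i, A i)} (hμ : ∀ x, 0 < μ x)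
    (sv : S → ℝ) (sμ : (Σ i, A i) → ℝ) (d : S → ℝ) :
    n * (ρ - ηv - ημ * ((Fintype.card (Σ i, A i) : ℝ) * (2 * b + 1) ^ 2) - 2 * κ) -
        crossEntropy μs μ / ημ - κ * ∑ i, d i ^ 2 -
        (Fintype.card S * b ^ 2 / (4 * κ) + (2 * b + 1)) ≤
      (smdLoop M.r b ηv ημ n v μ sv sμ).ev M.P
        fun o => M.potential ηv v μ sμ d (h o) o.2 := by
  induction n generalizing v μ sv sμ d with
  | zero =>
    have h1 := M.potential_lower_bound hηv hκ (hh (sv, sμ)) v d μ sμ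
    have h2 : 0 ≤ crossEntropy μs μ / ημ := div_nonneg (crossEntropy_nonneg _ _) hημ.le
    simp only [smdLoop, Alg.ev, Nat.cast_zero, zero_mul]
    linarith
  | succ n ih =>
    set E := ημ * ((Fintype.card (Σ i, A i) : ℝ) * (2 * b + 1) ^ 2) with hE
    set C := (Fintype.card S * b ^ 2 / (4 * κ) + (2 * b + 1)) with hC
    -- Everything seen by the first draw; the second one enters only through the cross entropy.
    set a : (Σ i, A i) → S → ℝ := fun x j =>
      (n * (ρ - ηv - E - 2 * κ) - C + mean μ M.r - ηv) + ∑ i, v i * gradV x j i -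
        κ * ∑ i, (d i + M.meanGradV μ i - gradV x j i) ^ 2 with ha
    have step : mean₂ M.P μ (fun x j => mean₂ M.P stdSimplex.barycenter fun y k =>
        a x j - ημ⁻¹ * crossEntropy μs (expStep ημ μ (gradMu M.r v y k))) ≤
        (smdLoop M.r b ηv ημ (n + 1) v μ sv sμ).ev M.P
          fun o => M.potential ηv v μ sμ d (h o) o.2 := by
      rw [smdLoop]
      refine mean₂_mono fun x j => mean₂_mono fun y k => ?_
      dsimp only
      have h1 := ih (abs_projBox_le hb (v - ηv • gradV x j))
        (expStep_pos ημ (gradMu M.r v y k) hμ) (sv + projBox b (v - ηv • gradV x j))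
        (sμ + ⇑(expStep ημ μ (gradMu M.r v y k)))
        (fun i => d i + M.meanGradV μ i - gradV x j i)
      have h2 := Alg.ev_mono (P := M.P) (fun o => M.potential_step hηv (hh o) v d μ
        (expStep ημ μ (gradMu M.r v y k)) sμ o.2 x j)
        (smdLoop M.r b ηv ημ n (projBox b (v - ηv • gradV x j))
          (expStep ημ μ (gradMu M.r v y k)) (sv + projBox b (v - ηv • gradV x j))
          (sμ + ⇑(expStep ημ μ (gradMu M.r v y k))))
      rw [Alg.ev_add_const] at h2
      refine le_trans ?_ h2
      simp only [ha]
      rw [div_eq_inv_mul] at h1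
      linarith
    refine le_trans ?_ step
    simp only [mean₂_sub, mean₂_const, mean₂_const_mul]
    have h3 := M.mean₂_crossEntropy_le hv hημ hηb μs hμ
    have h4 := mul_le_mul_of_nonneg_left (M.mean₂_noise_sq_le μ d) hκ.le
    have h5 : mean₂ M.P μ a = (n * (ρ - ηv - E - 2 * κ) - C - ηv) + M.lagr v μ -
        κ * mean₂ M.P μ (fun x j => ∑ i, (d i + M.meanGradV μ i - gradV x j i) ^ 2) := by
      rw [ha, mean₂_sub, mean₂_add, mean₂_const, mean₂_const_mul, M.mean₂_sum_mul_gradV,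
        M.lagr_eq v μ]
      ring
    have h6 := mul_le_mul_of_nonneg_left h3 (inv_nonneg.2 hημ.le)
    have h7 : ημ⁻¹ * (crossEntropy μs μ + ημ * (M.lagr v μ - M.lagr v μs) +
        ημ ^ 2 * ((Fintype.card (Σ i, A i) : ℝ) * (2 * b + 1) ^ 2)) =
        crossEntropy μs μ / ημ + (M.lagr v μ - ρ) + E := by
      rw [hρ, hE]
      field_simp
    rw [h7] at h6
    rw [h5]
    push_cast
    linarith

/-! ### The averaged output -/

lemma barycenter_pos {X : Type*} [Fintype X] [Nonempty X] (x : X) :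
    0 < (stdSimplex.barycenter : stdSimplex ℝ X) x := by
  change 0 < (Fintype.card X : ℝ)⁻¹
  have : 0 < Fintype.card X := Fintype.card_pos
  positivity

lemma smd_support [Nonempty (Σ i, A i)] {P : (Σ i, A i) → stdSimplex ℝ S}
    {r : (Σ i, A i) → ℝ} {b ηv ημ : ℝ} {T : ℕ} (hT : 1 ≤ T) {v₀ : S → ℝ}
    {o : ((S → ℝ) × ((Σ i, A i) → ℝ)) × ℕ}
    (ho : o ∈ ((smd r b ηv ημ T v₀).law P).support) :
    o.2 = 2 * T ∧ (∀ x, 0 < o.1.2 x) ∧ ∑ x, o.1.2 x = 1 := by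
  have hT0 : (0 : ℝ) < T := by exact_mod_cast hT
  obtain ⟨o, ho', rfl⟩ := Alg.mem_support_map ho
  obtain ⟨h1, h2, h3⟩ := smdLoop_support barycenter_pos ho'
  refine ⟨h1, fun x => mul_pos (inv_pos.2 hT0) ((h3 x).1 hT), ?_⟩
  simp only [Pi.smul_apply, smul_eq_mul, ← Finset.mul_sum, h2]
  simp [hT0.ne']

/-- The regret of the averaged output against a comparator that depends on it. -/
lemma MDP.smd_regret [Nonempty (Σ i, A i)] (M : MDP S A) {b ηv ημ κ : ℝ} (hb : 0 ≤ b)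
    (hηv : 0 < ηv) (hημ : 0 < ημ) (hκ : 0 < κ)
    (hηb : ημ * ((Fintype.card (Σ i, A i) : ℝ) * (2 * b + 1)) ≤ 1)
    {μs : stdSimplex ℝ (Σ i, A i)} {ρ : ℝ} (hρ : ∀ v, M.lagr v μs = ρ)
    {h : (S → ℝ) × ((Σ i, A i) → ℝ) → S → ℝ} (hh : ∀ o i, |h o i| ≤ b) {T : ℕ} (hT : 1 ≤ T)
    {v₀ : S → ℝ} (hv : ∀ i, |v₀ i| ≤ b) :
    T * (ρ - ηv - ημ * ((Fintype.card (Σ i, A i) : ℝ) * (2 * b + 1) ^ 2) - 2 * κ) -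
        Real.log (Fintype.card (Σ i, A i)) / ημ -
        (Fintype.card S * b ^ 2 / (4 * κ) + (2 * b + 1)) -
        (Fintype.card S * (2 * b) ^ 2 / (2 * ηv) + (2 * b + 1)) ≤
      T * (smd M.r b ηv ημ T v₀).ev M.P fun o => M.lagr (h o) o.2 := by
  have hT0 : (0 : ℝ) < T := by exact_mod_cast hT
  set g : (S → ℝ) × ((Σ i, A i) → ℝ) → (S → ℝ) × ((Σ i, A i) → ℝ) :=
    fun o => ((T : ℝ)⁻¹ • o.1, (T : ℝ)⁻¹ • o.2) with hg
  -- The loop returns sums and the comparator reads averages, hence the composition with g.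
  have h1 := M.smdLoop_regret hb hηv hημ hκ hηb hρ (h := fun o => h (g o))
    (fun o => hh (g o)) T hv barycenter_pos 0 0 0
  -- The regret concerns μ_0, …, μ_{T-1}, the output μ_1, …, μ_T. Removing μ_0 here costs 2 * b + 1,
  -- as did the last iterate at the other end.
  have h2 : ∀ o : (S → ℝ) × ((Σ i, A i) → ℝ),
      M.potential ηv v₀ stdSimplex.barycenter 0 0 (h (g o)) o.2 ≤ M.lagr (h (g o)) o.2 +
        (Fintype.card S * (2 * b) ^ 2 / (2 * ηv) + (2 * b + 1)) := by
    intro o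
    have h3 : ∑ i, (v₀ i - h (g o) i) ^ 2 ≤ Fintype.card S * (2 * b) ^ 2 := by
      rw [← nsmul_eq_mul]
      refine Finset.sum_le_card_nsmul _ _ _ fun i _ => sq_le_sq.2 ?_
      refine le_trans ?_ (le_abs_self _)
      have := abs_le.1 (hv i)
      have := abs_le.1 (hh (g o) i)
      rw [abs_le]; constructor <;> linarith
    have h4 := div_le_div_of_nonneg_right h3 (by linarith : 0 ≤ 2 * ηv)
    have h5 := (abs_le.1 (M.abs_lagr_le (hh (g o)) stdSimplex.barycenter)).2
    simp only [MDP.potential, sub_zero, M.lagr_add, Pi.zero_apply, zero_mul,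
      Finset.sum_const_zero, add_zero]
    linarith
  have h6 := h1.trans (Alg.ev_mono h2 _)
  rw [Alg.ev_add_const, crossEntropy_barycenter] at h6
  have h7 : (T : ℝ) * (smd M.r b ηv ημ T v₀).ev M.P (fun o => M.lagr (h o) o.2) =
      (smdLoop M.r b ηv ημ T v₀ stdSimplex.barycenter 0 0).ev M.P
        fun o => M.lagr (h (g o)) o.2 := by
    rw [smd, Alg.ev_map, ← Alg.ev_const_mul]
    congr 1
    funext o
    rw [M.lagr_smul, ← mul_assoc, mul_inv_cancel₀ hT0.ne', one_mul]
  rw [h7]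
  simp only [Pi.zero_apply, ne_eq, OfNat.ofNat_ne_zero, not_false_eq_true, zero_pow,
    Finset.sum_const_zero, mul_zero, sub_zero] at h6
  linarith

/-- With the chosen step sizes and number of iterations, all error terms are at most `ε`. -/
lemma regret_terms_le {ε t N s l T ρ : ℝ} (hε : 0 < ε) (hε1 : ε < 1) (ht : 1 ≤ t) (hN : 2 ≤ N)
    (hs : s ≤ N) (hl : 1 / 2 ≤ l) (hT : 3400 * (t ^ 2 * N * (ε ^ 2)⁻¹ * l) ≤ T) :
    T * (ρ - ε + ε / 8) ≤
      T * (ρ - 1 / 8 * ε - 1 / 1000 * ε / (t ^ 2 * N) * (N * (2 * (2 * (2 * t)) + 1) ^ 2) -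
          2 * (ε / 16)) - l / (1 / 1000 * ε / (t ^ 2 * N)) -
        (s * (2 * (2 * t)) ^ 2 / (4 * (ε / 16)) + (2 * (2 * (2 * t)) + 1)) -
        (s * (2 * (2 * (2 * t))) ^ 2 / (2 * (1 / 8 * ε)) + (2 * (2 * (2 * t)) + 1)) := by
  have ht0 : 0 < t := by linarith
  have hN0 : 0 < N := by linarith
  set Y := t ^ 2 * N / ε with hY
  have hE : 1 / 1000 * ε / (t ^ 2 * N) * (N * (2 * (2 * (2 * t)) + 1) ^ 2) ≤ ε / 8 := by
    have h1 : 1 / 1000 * ε / (t ^ 2 * N) * (N * (2 * (2 * (2 * t)) + 1) ^ 2) =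
        ε * ((8 * t + 1) ^ 2 / (1000 * t ^ 2)) := by
      field_simp
      ring
    have h2 : (8 * t + 1) ^ 2 / (1000 * t ^ 2) ≤ 1 / 8 := by
      rw [div_le_div_iff₀ (by positivity) (by norm_num)]
      nlinarith
    rw [h1]
    nlinarith
  have h3 : l / (1 / 1000 * ε / (t ^ 2 * N)) = 1000 * (Y * l) := by
    rw [hY]; field_simp
  have hst : s * t ^ 2 / ε ≤ Y := by
    rw [hY]
    refine div_le_div_of_nonneg_right ?_ hε.le
    nlinarith [sq_nonneg t]
  have h4 : s * (2 * (2 * t)) ^ 2 / (4 * (ε / 16)) = 64 * (s * t ^ 2 / ε) := by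
    field_simp; ring
  have h5 : s * (2 * (2 * (2 * t))) ^ 2 / (2 * (1 / 8 * ε)) = 256 * (s * t ^ 2 / ε) := by
    field_simp; ring
  have hY1 : 2 * t ≤ Y := by
    rw [hY, le_div_iff₀ hε]
    nlinarith [mul_nonneg ht0.le (sub_nonneg.2 hε1.le), mul_nonneg ht0.le (sub_nonneg.2 ht),
      mul_nonneg (sq_nonneg t) (sub_nonneg.2 hN)]
  have hY0 : 0 ≤ Y := by linarith
  have hYl : Y ≤ 2 * (Y * l) := by nlinarith
  -- The three errors proportional to T use 3εT/8 of the allowed 7εT/8. The others add up to at most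
  -- (1000 + 640 + 18)Yl, below 1700Yl ≤ εT/2.
  have hεT : 3400 * (Y * l) ≤ ε * T := by
    have h6 := mul_le_mul_of_nonneg_left hT hε.le
    have h7 : ε * (3400 * (t ^ 2 * N * (ε ^ 2)⁻¹ * l)) = 3400 * (Y * l) := by
      rw [hY]; field_simp
    linarith
  have hT0 : 0 ≤ T := by
    refine le_trans ?_ hT
    have : 0 ≤ l := by linarith
    positivity
  have hTE := mul_le_mul_of_nonneg_left hE hT0
  rw [h3, h4, h5]
  nlinarith

end AvgMDP

end

/-! ### Choice of constants and conclusion -/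

theorem mainTheorem1 :
    -- absolute constants
    ∃ cv cμ C : ℝ, 0 < cv ∧ 0 < cμ ∧ 0 < C ∧
      ∀ (S : Type u) (A : S → Type v) [Fintype S] [∀ i, Fintype (A i)] [∀ i, Nonempty (A i)]
        [Nonempty (Σ i, A i)], 2 ≤ Fintype.card (Σ i, A i) →
      ∀ (tmix : ℕ), 1 ≤ tmix → ∀ (ε : ℝ), 0 < ε → ε < 1 →
      -- the number of iterations, chosen without knowledge of the MDP
      ∃ T : ℕ, 1 ≤ T ∧
        ∀ (M : MDP S A), M.MixesWithin tmix →
        -- the initial point in the box of radius `2M = 4 * tmix`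
        ∀ (v₀ : S → ℝ), (∀ i, |v₀ i| ≤ 2 * (2 * (tmix : ℝ))) →
        ∀ (run : PMF (((S → ℝ) × ((Σ i, A i) → ℝ)) × ℕ)),
          run = (smd M.r (2 * (2 * (tmix : ℝ))) (cv * ε)
            (cμ * ε / ((tmix : ℝ) ^ 2 * (Fintype.card (Σ i, A i) : ℝ))) T v₀).law M.P →
        -- sample complexity
        (∀ o ∈ run.support, (o.2 : ℝ) ≤ C * ((tmix : ℝ) ^ 2 * (Fintype.card (Σ i, A i) : ℝ)
            * (ε ^ 2)⁻¹ * Real.log (Fintype.card (Σ i, A i) : ℝ))) ∧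
        -- the averaged output splits, uniquely, into state weights and a policy
        (∀ o ∈ run.support, ∃! lp : stdSimplex ℝ S × Policy S A,
            IsSplitting o.1.2 lp.1 lp.2) ∧
        ∀ (q : stdSimplex ℝ S),
          -- the average rewards are well defined
          (∀ π : Policy S A, Filter.Tendsto (M.meanReward q π) Filter.atTop
            (nhds (M.avgReward q π))) ∧
          -- the policy obtained by splitting is `ε`-optimal in expectation
          ∀ (pol : ((Σ i, A i) → ℝ) → Policy S A),
            (∀ o ∈ run.support, ∃ lam : stdSimplex ℝ S, IsSplitting o.1.2 lam (pol o.1.2)) →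
            M.optReward q - ε ≤ expect run (fun o => M.avgReward q (pol o.1.2)) := by
  refine ⟨1 / 8, 1 / 1000, 7000, by norm_num, by norm_num, by norm_num, ?_⟩
  intro S A _ _ _ _ hcard tmix htmix ε hε hε1
  set N : ℝ := (Fintype.card (Σ i, A i) : ℝ) with hN
  have hN2 : 2 ≤ N := by rw [hN]; exact_mod_cast hcard
  have ht : (1 : ℝ) ≤ tmix := by exact_mod_cast htmix
  have hl : 1 / 2 ≤ Real.log N :=
    (by linarith [Real.log_two_gt_d9] : (1 : ℝ) / 2 ≤ Real.log 2).trans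
      (Real.log_le_log (by norm_num) hN2)
  set X : ℝ := (tmix : ℝ) ^ 2 * N * (ε ^ 2)⁻¹ * Real.log N with hX
  have hX1 : 1 ≤ X := by
    have h1 : 1 ≤ (tmix : ℝ) ^ 2 := one_le_pow₀ ht
    have h2 : 1 ≤ (ε ^ 2)⁻¹ := (one_le_inv₀ (by positivity)).2 (pow_le_one₀ hε.le hε1.le)
    have h3 : 1 ≤ N * Real.log N := by nlinarith
    have h4 := one_le_mul_of_one_le_of_one_le (one_le_mul_of_one_le_of_one_le h1 h2) h3
    rw [hX]
    linarith
  have hT1 : 1 ≤ ⌈3400 * X⌉₊ := Nat.one_le_ceil_iff.2 (by linarith)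
  refine ⟨⌈3400 * X⌉₊, hT1, ?_⟩
  rintro M hM v₀ hv₀ run rfl
  refine ⟨fun o ho => ?_, fun o ho => ?_, fun q => ⟨fun π => ?_, fun pol hpol => ?_⟩⟩
  · rw [(smd_support hT1 ho).1]
    -- Two samples per iteration: 2T < 6800X + 2 ≤ 7000X, as X ≥ 1.
    have := Nat.ceil_lt_add_one (by linarith : 0 ≤ 3400 * X)
    push_cast
    linarith
  · obtain ⟨-, h1, h2⟩ := smd_support hT1 ho
    exact existsUnique_splitting h1 h2
  · obtain ⟨ν, t, hm, -⟩ := hM.exists_mixesAt π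
    rw [hm.avgReward_eq q]
    exact hm.tendsto_meanReward q
  · rw [sub_le_iff_le_add]
    have : Nonempty (Policy S A) := ⟨pol 0⟩
    refine ciSup_le fun π => ?_
    obtain ⟨ν, t, hm, -⟩ := hM.exists_mixesAt π
    rw [hm.avgReward_eq q, ← sub_le_iff_le_add]
    -- The comparator is the near-bias of the output policy; its slack ε / 8 uses up what the regret
    -- bound leaves.
    choose h hh hlagr using fun o : (S → ℝ) × ((Σ i, A i) → ℝ) =>
      hM.exists_lagr_le q (pol o.2) (by linarith : 0 < ε / 8)
    have hb : (0 : ℝ) ≤ 2 * (2 * tmix) := by positivity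
    have hηb : 1 / 1000 * ε / ((tmix : ℝ) ^ 2 * N) * (N * (2 * (2 * (2 * tmix)) + 1)) ≤ 1 := by
      have h1 : 1 / 1000 * ε / ((tmix : ℝ) ^ 2 * N) * (N * (2 * (2 * (2 * tmix)) + 1)) =
          ε * (8 * tmix + 1) / (1000 * (tmix : ℝ) ^ 2) := by
        field_simp
        ring
      rw [h1, div_le_one (by positivity)]
      nlinarith
    have hreg := M.smd_regret hb (by linarith : 0 < 1 / 8 * ε)
      (by positivity : 0 < 1 / 1000 * ε / ((tmix : ℝ) ^ 2 * N)) (by linarith : 0 < ε / 16) hηb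
      hm.stationary.lagr_occupancy (h := h)
      (fun o i => (hh o i).trans (by linarith)) hT1 hv₀
    -- Nonempty action sets let the |S| terms be absorbed in N.
    have hS : (Fintype.card S : ℝ) ≤ N := by
      rw [hN]
      exact_mod_cast Fintype.card_le_of_surjective (fun x : Σ i, A i => x.1)
        fun i => ⟨⟨i, Classical.arbitrary _⟩, rfl⟩
    have hnum := (regret_terms_le (ρ := M.statReward π ν) hε hε1 ht hN2 hS hl
      (Nat.le_ceil (3400 * X))).trans hreg
    have hev := le_of_mul_le_mul_left hnum (by exact_mod_cast hT1)
    have hle := Alg.ev_le_expect (P := M.P)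
      (F := fun o => M.lagr (h o) o.2 + -(ε / 8)) (G := fun o => M.avgReward q (pol o.2))
      (smd M.r (2 * (2 * (tmix : ℝ))) (1 / 8 * ε) (1 / 1000 * ε / ((tmix : ℝ) ^ 2 * N))
        ⌈3400 * X⌉₊ v₀) fun o ho => by
        obtain ⟨lam, hlam⟩ := hpol o ho
        linarith [hlagr o.1 o.1.2 lam hlam]
    rw [Alg.ev_add_const] at hle
    linarith
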